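/- Theorem. Let $a>0$, let $q:[-a,a]\to\mathbb{C}$ be continuous, and let $f:[-a,a]\to\mathbb{C}$ be a function without zeros such that $f$ and $1/f$ are bounded on $[-a,a]$, $f\in C^2(-a,a)$, $f''=qf$ on $(-a,a)$ and $f(0)=1$. Put $h:=f'(0)\in\mathbb{C}$. Define $X^{(0)}=\widetilde X^{(0)}=1$ and, for $n\ge 1$, $$X^{(n)}(x)=n\int_0^x X^{(n-1)}(s)\,\bigl(f^2(s)\bigr)^{(-1)^n}ds,\qquad \widetilde X^{(n)}(x)=n\int_0^x \widetilde X^{(n-1)}(s)\,\bigl(f^2(s)\bigr)^{(-1)^{n-1}}ds,$$ and let $\varphi_k=f\,X^{(k)}$ for odd $k$ and $\varphi_k=f\,\widetilde X^{(k)}$ for even $k$. Then the Goursat problem $$\frac{\partial^2 H(u,v)}{\partial u\,\partial v}=q(u+v)\,H(u,v),\qquad H(u,0)=\frac12\int_0^u q(s)\,ds,\qquad H(0,v)=0,$$ has exactly one solution $H$ on $D=\{(u,v)\in\mathbb{R}^2: uv\ge 0,\ |u+v|\le a\}$ (continuous on $D$, with the classical derivative $\partial_u(\partial_v H)$ existing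 and satisfying the equation at the points with $uv>0$, $|u+v|<a$). With $$K(x,t)=H\Bigl(\frac{x+t}2,\frac{x-t}2\Bigr),\qquad \mathbf K(x,t;h)=\frac h2+K(x,t)+\frac h2\int_t^x\bigl(K(x,s)-K(x,-s)\bigr)ds,$$ the operator $$\mathbf T_h u(x)=u(x)+\int_{-x}^{x}\mathbf K(x,t;h)\,u(t)\,dt$$ satisfies, for every $k\in\mathbb{N}_0$, $$\mathbf T_h[x^k](x)=\varphi_k(x)$$ for every $x\in(-a,a)$, and also at each of the end points $x=\pm a$ at which $f$ is continuous (so on all of $[-a,a]$ if $f\in C[-a,a]$). -/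

import Mathlib

namespace Transmutation

/-- The recursive integrals `X⁽ⁿ⁾` of `f` with base point `x₀`:
`X⁽⁰⁾ = 1`, `X⁽ⁿ⁾(x) = n ∫_{x₀}^x X⁽ⁿ⁻¹⁾(s) (f(s)²)^((-1)ⁿ) ds`. -/
noncomputable def recInt (f : ℝ → ℂ) (x₀ : ℝ) : ℕ → ℝ → ℂ
  | 0 => fun _ => 1
  | n + 1 => fun x =>
      ((n + 1 : ℕ) : ℂ) * ∫ s in x₀..x, recInt f x₀ n s * (f s ^ 2) ^ ((-1 : ℤ) ^ (n + 1))

/-- The recursive integrals `X̃⁽ⁿ⁾` of `f` with base point `x₀`: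
`X̃⁽⁰⁾ = 1`, `X̃⁽ⁿ⁾(x) = n ∫_{x₀}^x X̃⁽ⁿ⁻¹⁾(s) (f(s)²)^((-1)ⁿ⁻¹) ds`. -/
noncomputable def recIntTilde (f : ℝ → ℂ) (x₀ : ℝ) : ℕ → ℝ → ℂ
  | 0 => fun _ => 1
  | n + 1 => fun x =>
      ((n + 1 : ℕ) : ℂ) * ∫ s in x₀..x, recIntTilde f x₀ n s * (f s ^ 2) ^ ((-1 : ℤ) ^ n)

/-- `φ_k = f X⁽ᵏ⁾` for odd `k` and `φ_k = f X̃⁽ᵏ⁾` for even `k`. -/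
noncomputable def phi (f : ℝ → ℂ) (x₀ : ℝ) (k : ℕ) (x : ℝ) : ℂ :=
  if Odd k then f x * recInt f x₀ k x else f x * recIntTilde f x₀ k x

/-- The characteristic coordinates `u = (x + t) / 2`, `v = (x - t) / 2` of the points with
`|t| ≤ |x| ≤ a` (two triangles with the origin as common vertex). -/
def goursatDomain (a : ℝ) : Set (ℝ × ℝ) :=
  {p | 0 ≤ p.1 * p.2 ∧ |p.1 + p.2| ≤ a}

/-- `H` solves, on `goursatDomain a`, the Goursat problem
`∂²H/∂u∂v = q(u + v) H`, `H(u, 0) = (1/2) ∫_0^u q(s) ds`, `H(0, v) = 0`: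
it is continuous on the closed domain, takes the data on the characteristics, and satisfies
the equation, with classical derivatives, at every interior point. -/
structure IsGoursatSolution (q : ℝ → ℂ) (a : ℝ) (H : ℝ → ℝ → ℂ) : Prop where
  continuousOn : ContinuousOn (fun p : ℝ × ℝ => H p.1 p.2) (goursatDomain a)
  differentiableAt : ∀ u v : ℝ, 0 < u * v → |u + v| < a →
    DifferentiableAt ℝ (fun w => H u w) v
  equation : ∀ u v : ℝ, 0 < u * v → |u + v| < a →
    HasDerivAt (fun r => deriv (fun w => H r w) v) (q (u + v) * H u v) u
  data_left : ∀ u ∈ Set.Icc (-a) a, H u 0 = 1 / 2 * ∫ s in (0 : ℝ)..u, q s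
  data_right : ∀ v ∈ Set.Icc (-a) a, H 0 v = 0

/-- `K(x, t) = H((x + t) / 2, (x - t) / 2)`. -/
noncomputable def kernel (H : ℝ → ℝ → ℂ) (x t : ℝ) : ℂ :=
  H ((x + t) / 2) ((x - t) / 2)

/-- `K(x, t; h) = h/2 + K(x, t) + (h/2) ∫_t^x (K(x, s) - K(x, -s)) ds`. -/
noncomputable def kernelH (H : ℝ → ℝ → ℂ) (h : ℂ) (x t : ℝ) : ℂ :=
  h / 2 + kernel H x t + h / 2 * ∫ s in t..x, (kernel H x s - kernel H x (-s))

/-- `T_h u(x) = u(x) + ∫_{-x}^x K(x, t; h) u(t) dt`. -/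
noncomputable def opT (H : ℝ → ℝ → ℂ) (h : ℂ) (u : ℝ → ℂ) (x : ℝ) : ℂ :=
  u x + ∫ t in (-x)..x, kernelH H h x t * u t

end Transmutation

open MeasureTheory Filter Topology

/-! Write T for the operator 1 + ∫_{-x}^x K(x, t) · dt. It intertwines d²/dx² with d²/dx² − q:
(Tp)'' = q Tp + T(p'') for p of class C² (`hasDerivAt_transmuteDeriv`). Integration by parts moves
the h-terms of the kernel onto the argument, T_h u = T(u + (h/2) ∫_{-t}^t u) (`opT_eq_transmute`).
Hence T_h[x^k] = T p_k with polynomials p_k satisfying p_0 = 1 + hx, p_1 = x and p_{k+2}'' =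
(k+2)(k+1) p_k.

Therefore y_k = T p_k satisfies y_{k+2}'' − q y_{k+2} = (k+2)(k+1) y_k with zero Cauchy data at 0,
while y_0 and y_1 solve the homogeneous equation with data (1, h) and (0, 1). Pólya's factorization
y'' − qy = f⁻¹ (f² (y/f)')' solves each equation by two integrations, with weights f² and f⁻², which
is two steps of the recursion for the recursive integrals (`eqOn_mul_of_polya`, `transmute_powH`).
The end points follow by continuity.

The kernel comes from the integrated Goursat problem, solved by a Neumann series after extending q
to a bounded continuous function on the line: in the weight e^{l(|u|+|v|)} the double integral has
norm at most C/l² < 1. Uniqueness uses the same weight, with mean value inequalities on rectangles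
in place of the integral equation, because a solution is only assumed to satisfy the equation
pointwise inside the triangles (`goursat_eq_zero`). -/

namespace Transmutation

/-! ### Calculus: a Leibniz rule and an exponentially weighted bound -/

/-- Leibniz rule for `∫_0^x g(x, s) ds`. -/
theorem hasDerivAt_integral_leibniz {g g' : ℝ → ℝ → ℂ} (hg : Continuous (Function.uncurry g))
    (hg' : Continuous (Function.uncurry g')) (hd : ∀ x s, HasDerivAt (fun y => g y s) (g' x s) x)
    (x₀ : ℝ) :
    HasDerivAt (fun x => ∫ s in (0 : ℝ)..x, g x s)
      (g x₀ x₀ + ∫ s in (0 : ℝ)..x₀, g' x₀ s) x₀ := by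
  have cg : ∀ x, Continuous (g x) := fun x => by
    have : Continuous fun s => Function.uncurry g (x, s) := by fun_prop
    exact this
  have cg' : ∀ x, Continuous (g' x) := fun x => by
    have : Continuous fun s => Function.uncurry g' (x, s) := by fun_prop
    exact this
  have h1 : HasDerivAt (fun x => ∫ s in (0 : ℝ)..x₀, g x s) (∫ s in (0 : ℝ)..x₀, g' x₀ s) x₀ := by
    obtain ⟨M, hM⟩ := ((isCompact_Icc (a := x₀ - 1) (b := x₀ + 1)).prod
      (isCompact_uIcc (a := 0) (b := x₀))).exists_bound_of_continuousOn hg'.continuousOn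
    refine (intervalIntegral.hasDerivAt_integral_of_dominated_loc_of_deriv_le
      (s := Set.Icc (x₀ - 1) (x₀ + 1)) (bound := fun _ => M) (F := g) (F' := g')
      (Icc_mem_nhds (by linarith) (by linarith))
      (Eventually.of_forall fun x => (cg x).aestronglyMeasurable) ((cg x₀).intervalIntegrable _ _)
      (cg' x₀).aestronglyMeasurable ?_ intervalIntegrable_const
      (Eventually.of_forall fun s _ x _ => hd x s)).2
    exact Eventually.of_forall fun s hs x hx => hM (x, s) ⟨hx, Set.uIoc_subset_uIcc hs⟩
  -- The parameter moves together with the end point, so the fundamental theorem does not apply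
  -- directly; by joint continuity the integrand is within ε of `g x₀ x₀` on the whole short
  -- interval.
  have h2 : HasDerivAt (fun x => ∫ s in x₀..x, g x s) (g x₀ x₀) x₀ := by
    rw [hasDerivAt_iff_isLittleO, Asymptotics.isLittleO_iff]
    intro ε hε
    obtain ⟨δ, hδ, hδ'⟩ := Metric.continuousAt_iff.1 (hg.continuousAt (x := (x₀, x₀))) ε hε
    filter_upwards [Metric.ball_mem_nhds x₀ hδ] with x hx
    have hx' : |x - x₀| < δ := by simpa [Real.dist_eq] using hx
    have e : (∫ s in x₀..x, g x s) - (∫ s in x₀..x₀, g x₀ s) - (x - x₀) • g x₀ x₀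
        = ∫ s in x₀..x, (g x s - g x₀ x₀) := by
      rw [intervalIntegral.integral_sub ((cg x).intervalIntegrable _ _) intervalIntegrable_const]
      simp
    rw [e]
    refine intervalIntegral.norm_integral_le_of_norm_le_const fun s hs => ?_
    have hs' : |s - x₀| < δ :=
      (Set.abs_sub_left_of_mem_uIcc (Set.uIoc_subset_uIcc hs)).trans_lt hx'
    have := hδ' (x := (x, s)) (by simpa [Prod.dist_eq, Real.dist_eq] using ⟨hx', hs'⟩)
    rw [dist_eq_norm] at this
    exact this.le
  have h := h2.add h1
  refine h.congr_of_eventuallyEq (Eventually.of_forall fun x => ?_)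
  simp only [Pi.add_apply]
  rw [add_comm, intervalIntegral.integral_add_adjacent_intervals ((cg x).intervalIntegrable _ _)
    ((cg x).intervalIntegrable _ _)]

/-- Integrating e^{l|s|} from 0 gains a factor 1/l; this gain is what makes the iteration below
contract. -/
theorem norm_integral_le_exp {φ : ℝ → ℂ} {B l u : ℝ} (hB : 0 ≤ B) (hl : 0 < l)
    (hφ : ∀ s, ‖φ s‖ ≤ B * Real.exp (l * |s|)) :
    ‖∫ s in (0 : ℝ)..u, φ s‖ ≤ B / l * Real.exp (l * |u|) := by
  have key : ∀ (ψ : ℝ → ℂ) (w : ℝ), 0 ≤ w → (∀ s, ‖ψ s‖ ≤ B * Real.exp (l * |s|)) →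
      ‖∫ s in (0 : ℝ)..w, ψ s‖ ≤ B / l * Real.exp (l * w) := by
    intro ψ w hw hψ
    have h1 : ‖∫ s in (0 : ℝ)..w, ψ s‖ ≤ ∫ s in (0 : ℝ)..w, B * Real.exp (l * s) := by
      refine intervalIntegral.norm_integral_le_of_norm_le hw ?_
        (Continuous.intervalIntegrable (by fun_prop) _ _)
      refine Eventually.of_forall fun s hs => ?_
      have := hψ s
      rwa [abs_of_pos hs.1] at this
    have h2 : ∫ s in (0 : ℝ)..w, B * Real.exp (l * s) = B / l * (Real.exp (l * w) - 1) := by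
      rw [intervalIntegral.integral_const_mul, intervalIntegral.integral_comp_mul_left _ hl.ne']
      simp
      ring
    rw [h2] at h1
    have : 0 ≤ B / l := by positivity
    nlinarith
  rcases le_total 0 u with hu | hu
  · simpa [abs_of_nonneg hu] using key φ u hu hφ
  · have h := key (fun s => φ (-s)) (-u) (by linarith) (fun s => by simpa using hφ (-s))
    rw [intervalIntegral.integral_comp_neg] at h
    rw [abs_of_nonpos hu, intervalIntegral.integral_symm, norm_neg]
    simpa using h

/-! ### The Goursat integral equation by a Neumann series -/

/-- The double integral `∫_0^v ∫_0^u Q(s + w) F(s, w) ds dw`. -/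
noncomputable def goursatInt (Q : ℝ → ℂ) (F : ℝ × ℝ → ℂ) (p : ℝ × ℝ) : ℂ :=
  ∫ w in (0 : ℝ)..p.2, ∫ s in (0 : ℝ)..p.1, Q (s + w) * F (s, w)

theorem continuous_integral_goursat {Q : ℝ → ℂ} {F : ℝ × ℝ → ℂ} (hQ : Continuous Q)
    (hF : Continuous F) :
    Continuous fun p : ℝ × ℝ => ∫ s in (0 : ℝ)..p.1, Q (s + p.2) * F (s, p.2) :=
  intervalIntegral.continuous_parametric_intervalIntegral_of_continuous
    (f := fun (p : ℝ × ℝ) s => Q (s + p.2) * F (s, p.2))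
    (by simp only [Function.uncurry_def]; fun_prop) continuous_fst

theorem continuous_goursatInt {Q : ℝ → ℂ} {F : ℝ × ℝ → ℂ} (hQ : Continuous Q)
    (hF : Continuous F) : Continuous (goursatInt Q F) := by
  have h := continuous_integral_goursat hQ hF
  exact intervalIntegral.continuous_parametric_intervalIntegral_of_continuous
    (f := fun (p : ℝ × ℝ) w => ∫ s in (0 : ℝ)..p.1, Q (s + w) * F (s, w))
    (by
      simp only [Function.uncurry_def]
      exact h.comp (g := fun p : ℝ × ℝ => ∫ s in (0 : ℝ)..p.1, Q (s + p.2) * F (s, p.2))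
        (f := fun x : (ℝ × ℝ) × ℝ => (x.1.1, x.2)) (by fun_prop)) continuous_snd

theorem norm_integral_goursat_le {Q : ℝ → ℂ} {F : ℝ × ℝ → ℂ} {B C l : ℝ} (hB : 0 ≤ B) (hC : 0 ≤ C)
    (hl : 0 < l) (hQ : ∀ x, ‖Q x‖ ≤ C) (hF : ∀ p, ‖F p‖ ≤ B * Real.exp (l * (|p.1| + |p.2|)))
    (u v : ℝ) :
    ‖∫ s in (0 : ℝ)..u, Q (s + v) * F (s, v)‖ ≤ B * C / l * Real.exp (l * (|u| + |v|)) := by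
  have := norm_integral_le_exp (φ := fun s => Q (s + v) * F (s, v)) (u := u)
    (B := B * C * Real.exp (l * |v|)) (by positivity) hl (fun s => by
      rw [norm_mul]
      calc _ ≤ C * (B * Real.exp (l * (|s| + |v|))) :=
            mul_le_mul (hQ _) (hF _) (norm_nonneg _) hC
        _ = _ := by rw [mul_add, Real.exp_add]; ring)
  refine this.trans_eq ?_
  rw [mul_add, Real.exp_add]; ring

theorem norm_goursatInt_le {Q : ℝ → ℂ} {F : ℝ × ℝ → ℂ} {B C l : ℝ} (hB : 0 ≤ B) (hC : 0 ≤ C)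
    (hl : 0 < l) (hQ : ∀ x, ‖Q x‖ ≤ C) (hF : ∀ p, ‖F p‖ ≤ B * Real.exp (l * (|p.1| + |p.2|)))
    (p : ℝ × ℝ) :
    ‖goursatInt Q F p‖ ≤ B * (C / l ^ 2) * Real.exp (l * (|p.1| + |p.2|)) := by
  have := norm_integral_le_exp (φ := fun w => ∫ s in (0 : ℝ)..p.1, Q (s + w) * F (s, w)) (u := p.2)
    (B := B * C / l * Real.exp (l * |p.1|)) (by positivity) hl (fun w => by
      refine (norm_integral_goursat_le hB hC hl hQ hF p.1 w).trans_eq ?_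
      rw [mul_add, Real.exp_add]; ring)
  refine this.trans_eq ?_
  rw [mul_add, Real.exp_add]; field_simp

/-- The integral form of the Goursat problem on the plane, with bounded continuous coefficient. -/
theorem exists_goursat_integral_eq {Q : ℝ → ℂ} (hQc : Continuous Q) {C : ℝ} (hQ : ∀ x, ‖Q x‖ ≤ C) :
    ∃ H : ℝ × ℝ → ℂ, Continuous H ∧
      ∀ p, H p = 1 / 2 * (∫ s in (0 : ℝ)..p.1, Q s) + goursatInt Q H p := by
  have hC : 0 ≤ C := (norm_nonneg _).trans (hQ 0)
  -- Any l > 0 with l² > C would do; l = C + 1 gives the ratio θ = C/(C+1)² < 1, also when C = 0.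
  set l : ℝ := C + 1 with hl
  have hl0 : 0 < l := by positivity
  set θ : ℝ := C / l ^ 2 with hθ
  have hθ0 : 0 ≤ θ := by positivity
  have hθ1 : θ < 1 := by rw [hθ, div_lt_one (by positivity)]; nlinarith
  let S : ℕ → ℝ × ℝ → ℂ := fun n =>
    Nat.rec (fun p => 1 / 2 * (∫ s in (0 : ℝ)..p.1, Q s)) (fun _ F => goursatInt Q F) n
  have S0 : S 0 = fun p => 1 / 2 * (∫ s in (0 : ℝ)..p.1, Q s) := rfl
  have SS : ∀ n, S (n + 1) = goursatInt Q (S n) := fun _ => rfl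
  have Sc : ∀ n, Continuous (S n) := by
    intro n
    induction n with
    | zero =>
      rw [S0]
      exact continuous_const.mul ((intervalIntegral.continuous_primitive
        (fun a b => hQc.intervalIntegrable a b) 0).comp continuous_fst)
    | succ n ih => rw [SS]; exact continuous_goursatInt hQc ih
  set A : ℝ := C / l with hA
  have hA0 : 0 ≤ A := by positivity
  have Sb : ∀ n p, ‖S n p‖ ≤ A * θ ^ n * Real.exp (l * (|p.1| + |p.2|)) := by
    intro n
    induction n with
    | zero =>
      intro p
      have h := norm_integral_le_exp (φ := Q) (B := C) (u := p.1) hC hl0 (fun s =>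
        (hQ s).trans (le_mul_of_one_le_right hC (Real.one_le_exp (by positivity))))
      have h2 : Real.exp (l * |p.1|) ≤ Real.exp (l * (|p.1| + |p.2|)) :=
        Real.exp_le_exp.2 (mul_le_mul_of_nonneg_left (by linarith [abs_nonneg p.2]) hl0.le)
      have h3 := mul_le_mul_of_nonneg_left h2 hA0
      rw [S0]
      simp only [norm_mul, pow_zero, mul_one]
      have h4 : ‖(1 / 2 : ℂ)‖ ≤ 1 := by norm_num
      calc _ ≤ 1 * ‖∫ s in (0 : ℝ)..p.1, Q s‖ := mul_le_mul_of_nonneg_right h4 (norm_nonneg _)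
        _ ≤ _ := by rw [one_mul]; exact h.trans h3
    | succ n ih =>
      intro p
      rw [SS]
      refine (norm_goursatInt_le (by positivity) hC hl0 hQ ih p).trans_eq ?_
      rw [pow_succ]; ring
  have gs : Summable fun n => A * θ ^ n := (summable_geometric_of_lt_one hθ0 hθ1).mul_left A
  have Ssum : ∀ p, Summable fun n => S n p := fun p =>
    Summable.of_norm_bounded (gs.mul_right _) (fun n => Sb n p)
  have Hc : Continuous fun p => ∑' n, S n p := by
    rw [continuous_iff_continuousAt]
    intro p
    have hn : Metric.ball p 1 ∈ 𝓝 p := Metric.ball_mem_nhds p one_pos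
    refine ContinuousOn.continuousAt (s := Metric.ball p 1) ?_ hn
    -- On the unit ball about p each |coordinate| grows by less than 1, hence the 2 in the exponent.
    refine continuousOn_tsum (u := fun n => A * θ ^ n * Real.exp (l * (|p.1| + |p.2| + 2)))
      (fun n => (Sc n).continuousOn) (gs.mul_right _) ?_
    intro n x hx
    refine (Sb n x).trans (mul_le_mul_of_nonneg_left (Real.exp_le_exp.2
      (mul_le_mul_of_nonneg_left ?_ hl0.le)) (by positivity))
    rw [Metric.mem_ball, Prod.dist_eq, max_lt_iff, Real.dist_eq, Real.dist_eq] at hx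
    have h1 := abs_sub_abs_le_abs_sub x.1 p.1
    have h2 := abs_sub_abs_le_abs_sub x.2 p.2
    linarith [hx.1, hx.2]
  refine ⟨fun p => ∑' n, S n p, Hc, fun p => ?_⟩
  have inner : ∀ u w, HasSum (fun n => ∫ s in (0 : ℝ)..u, Q (s + w) * S n (s, w))
      (∫ s in (0 : ℝ)..u, Q (s + w) * ∑' n, S n (s, w)) := by
    intro u w
    refine intervalIntegral.hasSum_integral_of_dominated_convergence
      (fun n s => C * (A * θ ^ n * Real.exp (l * (|s| + |w|)))) (fun n => ?_) (fun n => ?_)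
      ?_ ?_ ?_
    · have := Sc n
      exact Continuous.aestronglyMeasurable (by fun_prop)
    · refine Eventually.of_forall fun s _ => ?_
      rw [norm_mul]
      exact mul_le_mul (hQ _) (Sb n (s, w)) (norm_nonneg _) hC
    · exact Eventually.of_forall fun s _ => (gs.mul_right _).mul_left C
    · simp_rw [tsum_mul_left, tsum_mul_right]
      exact Continuous.intervalIntegrable (by fun_prop) _ _
    · exact Eventually.of_forall fun s _ => ((Ssum (s, w)).hasSum).mul_left _
  -- The double integral commutes with the sum, so applying it to the series shifts the index by one
  -- and leaves out only `S 0`.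
  have outer : HasSum (fun n => goursatInt Q (S n) p)
      (goursatInt Q (fun p => ∑' n, S n p) p) := by
    refine intervalIntegral.hasSum_integral_of_dominated_convergence
      (fun n w => A * θ ^ n * (C / l) * Real.exp (l * (|p.1| + |w|))) (fun n => ?_) (fun n => ?_)
      ?_ ?_ ?_
    · have := (continuous_integral_goursat hQc (Sc n)).comp (g := fun p : ℝ × ℝ =>
        ∫ s in (0 : ℝ)..p.1, Q (s + p.2) * S n (s, p.2)) (f := fun w : ℝ => (p.1, w)) (by fun_prop)
      exact this.aestronglyMeasurable
    · refine Eventually.of_forall fun w _ => ?_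
      refine (norm_integral_goursat_le (by positivity) hC hl0 hQ (Sb n) p.1 w).trans_eq (by ring)
    · exact Eventually.of_forall fun s _ => (gs.mul_right _).mul_right _
    · simp_rw [tsum_mul_right]
      exact Continuous.intervalIntegrable (by fun_prop) _ _
    · exact Eventually.of_forall fun w _ => inner p.1 w
  show ∑' n, S n p = _
  rw [(Ssum p).tsum_eq_zero_add, ← outer.tsum_eq]
  rfl

/-! ### The transmutation operator in characteristic coordinates -/

/-- The operator `1 + ∫_{-x}^x K(x, t) · dt` in characteristic coordinates. -/
noncomputable def transmute (H : ℝ × ℝ → ℂ) (p : ℝ → ℂ) (x : ℝ) : ℂ :=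
  p x + 2 * ∫ s in (0 : ℝ)..x, H (s, x - s) * p (2 * s - x)

/-- Substitution t = 2s − x, under which (x + t)/2 = s and (x − t)/2 = x − s; the factor 2 is its
Jacobian. -/
theorem integral_kernel_mul (H : ℝ × ℝ → ℂ) (p : ℝ → ℂ) (x : ℝ) :
    ∫ t in (-x)..x, kernel (fun u v => H (u, v)) x t * p t
      = 2 * ∫ s in (0 : ℝ)..x, H (s, x - s) * p (2 * s - x) := by
  have h := intervalIntegral.smul_integral_comp_mul_sub
    (a := 0) (b := x) (fun t => kernel (fun u v => H (u, v)) x t * p t) 2 x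
  have e1 : (2 : ℝ) * 0 - x = -x := by ring
  have e2 : 2 * x - x = x := by ring
  rw [e1, e2] at h
  rw [← h, Complex.real_smul]
  push_cast
  congr 1
  refine intervalIntegral.integral_congr fun s _ => ?_
  have e3 : (x + (2 * s - x)) / 2 = s := by ring
  have e4 : (x - (2 * s - x)) / 2 = x - s := by ring
  simp only [kernel, e3, e4]

theorem transmute_const_mul (H : ℝ × ℝ → ℂ) (c : ℂ) (p : ℝ → ℂ) (x : ℝ) :
    transmute H (fun t => c * p t) x = c * transmute H p x := by
  have : ∀ s, H (s, x - s) * (c * p (2 * s - x)) = c * (H (s, x - s) * p (2 * s - x)) :=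
    fun s => by ring
  simp only [transmute, this, intervalIntegral.integral_const_mul]
  ring

/-- Integrate by parts, differentiating G(t) = ∫_t^x (K(x, s) − K(x, −s)) ds. Both boundary terms
vanish: G(x) = 0 trivially, and G(−x) = 0 because the integrand is odd in s. Reflecting t ↦ −t then
leaves K(x, t) against ∫_{-t}^t u. -/
theorem opT_eq_transmute {H : ℝ × ℝ → ℂ} (hH : Continuous H) (h : ℂ) {u : ℝ → ℂ}
    (hu : Continuous u) (x : ℝ) :
    opT (fun a b => H (a, b)) h u x
      = transmute H (fun t => u t + h / 2 * ∫ s in (-t)..t, u s) x := by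
  set k : ℝ → ℂ := fun t => kernel (fun u v => H (u, v)) x t with hk
  have kc : Continuous k := by simp only [hk, kernel]; fun_prop
  set U : ℝ → ℂ := fun t => ∫ s in (0 : ℝ)..t, u s with hU
  have Ud : ∀ t, HasDerivAt U (u t) t := fun t => (hu.integral_hasStrictDerivAt 0 t).hasDerivAt
  have Uc : Continuous U := continuous_iff_continuousAt.2 fun t => (Ud t).continuousAt
  have hw : ∀ t, ∫ s in (-t)..t, u s = U t - U (-t) := fun t =>
    (intervalIntegral.integral_interval_sub_left (hu.intervalIntegrable _ _)
      (hu.intervalIntegrable _ _)).symm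
  set d : ℝ → ℂ := fun s => k s - k (-s) with hd
  have dc : Continuous d := by fun_prop
  set G : ℝ → ℂ := fun t => ∫ s in t..x, d s with hG
  have Gd : ∀ t, HasDerivAt G (-d t) t := fun t =>
    intervalIntegral.integral_hasDerivAt_left (dc.intervalIntegrable _ _)
      (dc.stronglyMeasurableAtFilter _ _) dc.continuousAt
  have Gc : Continuous G := continuous_iff_continuousAt.2 fun t => (Gd t).continuousAt
  have Gx : G x = 0 := by simp [hG]
  have kneg : ∀ V : ℝ → ℂ, ∫ t in (-x)..x, k (-t) * V t = ∫ t in (-x)..x, k t * V (-t) := by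
    intro V
    have := intervalIntegral.integral_comp_neg (a := -x) (b := x) (fun t => k t * V (-t))
    simpa using this
  have Gnx : G (-x) = 0 := by
    have h1 := kneg (fun _ => 1)
    simp only [mul_one] at h1
    simp only [hG, hd]
    rw [intervalIntegral.integral_sub (kc.intervalIntegrable _ _)
      (Continuous.intervalIntegrable (by fun_prop) _ _), h1, sub_self]
  have parts : ∫ t in (-x)..x, G t * u t = ∫ t in (-x)..x, k t * (U t - U (-t)) := by
    rw [intervalIntegral.integral_mul_deriv_eq_deriv_mul (u := G) (v := U) (u' := fun t => -d t)
      (v' := u) (fun t _ => Gd t) (fun t _ => Ud t) (dc.neg.intervalIntegrable _ _)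
      (hu.intervalIntegrable _ _), Gx, Gnx]
    have e : ∀ t, -d t * U t = k (-t) * U t - k t * U t := fun t => by simp only [hd]; ring
    simp only [e, mul_sub]
    rw [intervalIntegral.integral_sub (Continuous.intervalIntegrable (by fun_prop) _ _)
      (Continuous.intervalIntegrable (by fun_prop) _ _), kneg,
      intervalIntegral.integral_sub (Continuous.intervalIntegrable (by fun_prop) _ _)
      (Continuous.intervalIntegrable (by fun_prop) _ _)]
    ring
  have e : ∀ t, kernelH (fun a b => H (a, b)) h x t * u t
      = h / 2 * u t + k t * u t + h / 2 * (G t * u t) := by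
    intro t
    simp only [kernelH, hG, hd, hk]
    ring
  have e3 := integral_kernel_mul H (fun t => u t + h / 2 * ∫ s in (-t)..t, u s) x
  beta_reduce at e3
  simp only [opT, e]
  rw [transmute, ← e3, intervalIntegral.integral_add
      (Continuous.intervalIntegrable (by fun_prop) _ _)
      (Continuous.intervalIntegrable (by fun_prop) _ _), intervalIntegral.integral_add
      (Continuous.intervalIntegrable (by fun_prop) _ _)
      (Continuous.intervalIntegrable (by fun_prop) _ _), intervalIntegral.integral_const_mul,
      intervalIntegral.integral_const_mul, parts]
  have e2 : ∀ t, kernel (fun u v => H (u, v)) x t * (u t + h / 2 * ∫ s in (-t)..t, u s)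
      = k t * u t + h / 2 * (k t * (U t - U (-t))) := by
    intro t
    rw [hw]
    simp only [hk]
    ring
  simp only [e2]
  rw [intervalIntegral.integral_add
      (Continuous.intervalIntegrable (by fun_prop) _ _)
      (Continuous.intervalIntegrable (by fun_prop) _ _), intervalIntegral.integral_const_mul]
  ring

/-! ### Differentiating the transmutation operator twice -/

/-- The derivative in `v` of a solution of the integral form of the Goursat problem. -/
noncomputable def goursatDeriv (Q : ℝ → ℂ) (H : ℝ × ℝ → ℂ) (p : ℝ × ℝ) : ℂ :=
  ∫ s in (0 : ℝ)..p.1, Q (s + p.2) * H (s, p.2)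

section Regularity

variable {Q : ℝ → ℂ} {H : ℝ × ℝ → ℂ}

theorem hasDerivAt_goursat_snd (hQ : Continuous Q) (hH : Continuous H)
    (heq : ∀ p, H p = 1 / 2 * (∫ s in (0 : ℝ)..p.1, Q s) + goursatInt Q H p) (u v : ℝ) :
    HasDerivAt (fun w => H (u, w)) (goursatDeriv Q H (u, v)) v := by
  have hc : Continuous fun w => goursatDeriv Q H (u, w) :=
    (continuous_integral_goursat hQ hH).comp (by fun_prop : Continuous fun w : ℝ => (u, w))
  have h := ((hc.integral_hasStrictDerivAt 0 v).hasDerivAt).const_add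
    (1 / 2 * (∫ s in (0 : ℝ)..u, Q s))
  exact h.congr_of_eventuallyEq (Eventually.of_forall fun w => heq (u, w))

theorem hasDerivAt_goursatDeriv_fst (hQ : Continuous Q) (hH : Continuous H) (u v : ℝ) :
    HasDerivAt (fun r => goursatDeriv Q H (r, v)) (Q (u + v) * H (u, v)) u :=
  ((by fun_prop : Continuous fun s => Q (s + v) * H (s, v)).integral_hasStrictDerivAt 0 u).hasDerivAt

theorem goursat_snd_zero
    (heq : ∀ p, H p = 1 / 2 * (∫ s in (0 : ℝ)..p.1, Q s) + goursatInt Q H p) (u : ℝ) :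
    H (u, 0) = 1 / 2 * ∫ s in (0 : ℝ)..u, Q s := by
  rw [heq]; simp [goursatInt]

theorem goursat_fst_zero
    (heq : ∀ p, H p = 1 / 2 * (∫ s in (0 : ℝ)..p.1, Q s) + goursatInt Q H p) (v : ℝ) :
    H (0, v) = 0 := by
  rw [heq]; simp [goursatInt]

/-- The derivative of `transmute H p`. -/
noncomputable def transmuteDeriv (Q : ℝ → ℂ) (H : ℝ × ℝ → ℂ) (p p' : ℝ → ℂ) (x : ℝ) : ℂ :=
  p' x + 2 * (H (x, 0) * p x + ((∫ s in (0 : ℝ)..x, goursatDeriv Q H (s, x - s) * p (2 * s - x))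
    - ∫ s in (0 : ℝ)..x, H (s, x - s) * p' (2 * s - x)))

variable {p p' p'' : ℝ → ℂ}

/-- For fixed s the variable x enters `H` only through its second coordinate, so only the derivative
in v is needed. -/
theorem hasDerivAt_transmute_integral (hQ : Continuous Q) (hH : Continuous H)
    (heq : ∀ p, H p = 1 / 2 * (∫ s in (0 : ℝ)..p.1, Q s) + goursatInt Q H p)
    (hp : ∀ t, HasDerivAt p (p' t) t) (hp' : Continuous p') (x : ℝ) :
    HasDerivAt (fun x => ∫ s in (0 : ℝ)..x, H (s, x - s) * p (2 * s - x))
      (H (x, 0) * p x + ((∫ s in (0 : ℝ)..x, goursatDeriv Q H (s, x - s) * p (2 * s - x))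
        - ∫ s in (0 : ℝ)..x, H (s, x - s) * p' (2 * s - x))) x := by
  have pc : Continuous p := continuous_iff_continuousAt.2 fun t => (hp t).continuousAt
  have dc : Continuous (goursatDeriv Q H) := continuous_integral_goursat hQ hH
  have h := hasDerivAt_integral_leibniz (g := fun x s => H (s, x - s) * p (2 * s - x))
    (g' := fun x s => goursatDeriv Q H (s, x - s) * p (2 * s - x)
      - H (s, x - s) * p' (2 * s - x)) (by simp only [Function.uncurry_def]; fun_prop)
    (by simp only [Function.uncurry_def]; fun_prop)
    (fun x s => by
      have h1 := (hasDerivAt_goursat_snd hQ hH heq s (x - s)).comp_sub_const x s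
      have h2 := (hp (2 * s - x)).comp_const_sub (2 * s) x
      exact (h1.mul h2).congr_deriv (by ring)) x
  refine h.congr_deriv ?_
  rw [intervalIntegral.integral_sub (Continuous.intervalIntegrable (by fun_prop) _ _)
      (Continuous.intervalIntegrable (by fun_prop) _ _), sub_self]
  congr 3
  ring

theorem hasDerivAt_transmute (hQ : Continuous Q) (hH : Continuous H)
    (heq : ∀ p, H p = 1 / 2 * (∫ s in (0 : ℝ)..p.1, Q s) + goursatInt Q H p)
    (hp : ∀ t, HasDerivAt p (p' t) t) (hp' : Continuous p') (x : ℝ) :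
    HasDerivAt (transmute H p) (transmuteDeriv Q H p p' x) x :=
  (hp x).add ((hasDerivAt_transmute_integral hQ hH heq hp hp' x).const_mul 2)

/-- Since `Q` is merely continuous, ∂_v H need not be differentiable in v. Changing variables to v =
x − s puts x into the first coordinate, where ∂_u ∂_v H = Q(u + v) H applies; along the path u + v =
x, so `Q x` leaves the integral. The datum H(x, 0) supplies Q p, and the terms H(x, 0) p' and ∫ ∂_v
H p' cancel. -/
theorem hasDerivAt_transmuteDeriv (hQ : Continuous Q) (hH : Continuous H)
    (heq : ∀ p, H p = 1 / 2 * (∫ s in (0 : ℝ)..p.1, Q s) + goursatInt Q H p)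
    (hp : ∀ t, HasDerivAt p (p' t) t) (hp' : ∀ t, HasDerivAt p' (p'' t) t)
    (hp'' : Continuous p'') (x : ℝ) :
    HasDerivAt (transmuteDeriv Q H p p') (Q x * transmute H p x + transmute H p'' x) x := by
  have pc : Continuous p := continuous_iff_continuousAt.2 fun t => (hp t).continuousAt
  have pc' : Continuous p' := continuous_iff_continuousAt.2 fun t => (hp' t).continuousAt
  have dc : Continuous (goursatDeriv Q H) := continuous_integral_goursat hQ hH
  have flip : ∀ (F : ℝ × ℝ → ℂ) (r : ℝ → ℂ) (x : ℝ),
      ∫ s in (0 : ℝ)..x, F (s, x - s) * r (2 * s - x)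
        = ∫ v in (0 : ℝ)..x, F (x - v, v) * r (x - 2 * v) := by
    intro F r x
    have := intervalIntegral.integral_comp_sub_left (a := 0) (b := x)
      (fun s => F (s, x - s) * r (2 * s - x)) x
    simp only [sub_self, sub_zero, sub_sub_cancel] at this
    rw [← this]
    refine intervalIntegral.integral_congr fun v _ => ?_
    congr 2
    ring
  have h1 : HasDerivAt (fun x => H (x, 0)) (1 / 2 * Q x) x :=
    (((hQ.integral_hasStrictDerivAt 0 x).hasDerivAt).const_mul (1 / 2)).congr_of_eventuallyEq
      (Eventually.of_forall fun u => goursat_snd_zero heq u)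
  have h2 : HasDerivAt (fun x => ∫ s in (0 : ℝ)..x, goursatDeriv Q H (s, x - s) * p (2 * s - x))
      (Q x * (∫ s in (0 : ℝ)..x, H (s, x - s) * p (2 * s - x))
        + ∫ s in (0 : ℝ)..x, goursatDeriv Q H (s, x - s) * p' (2 * s - x)) x := by
    have h := hasDerivAt_integral_leibniz
      (g := fun x v => goursatDeriv Q H (x - v, v) * p (x - 2 * v))
      (g' := fun x v => Q x * (H (x - v, v) * p (x - 2 * v))
        + goursatDeriv Q H (x - v, v) * p' (x - 2 * v))
      (by simp only [Function.uncurry_def]; fun_prop)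
      (by simp only [Function.uncurry_def]; fun_prop)
      (fun x v => by
        have h1 := (hasDerivAt_goursatDeriv_fst hQ hH (x - v) v).comp_sub_const x v
        have h2 := (hp (x - 2 * v)).comp_sub_const x (2 * v)
        rw [sub_add_cancel] at h1
        exact (h1.mul h2).congr_deriv (by ring)) x
    simp_rw [flip]
    refine h.congr_deriv ?_
    rw [intervalIntegral.integral_add (Continuous.intervalIntegrable (by fun_prop) _ _)
      (Continuous.intervalIntegrable (by fun_prop) _ _), intervalIntegral.integral_const_mul]
    -- The boundary term at v = x contains ∂_v H(0, x), an integral from 0 to 0.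
    simp [goursatDeriv]
  have h3 := hasDerivAt_transmute_integral hQ hH heq hp' hp'' x
  refine ((hp' x).add (((h1.mul (hp x)).add (h2.sub h3)).const_mul 2)).congr_deriv ?_
  simp only [transmute]
  ring

end Regularity

/-! ### The recursive integrals along one parity -/

/-- The recursive integral of the parity that enters `phi`. -/
noncomputable def recA (f : ℝ → ℂ) (k : ℕ) : ℝ → ℂ :=
  if Odd k then recInt f 0 k else recIntTilde f 0 k

/-- The recursive integral of the parity opposite to the one that enters `phi`. -/
noncomputable def recB (f : ℝ → ℂ) (k : ℕ) : ℝ → ℂ :=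
  if Odd k then recIntTilde f 0 k else recInt f 0 k

theorem phi_eq_mul_recA (f : ℝ → ℂ) (k : ℕ) (x : ℝ) : phi f 0 k x = f x * recA f k x := by
  unfold phi recA
  split_ifs <;> rfl

theorem recA_zero (f : ℝ → ℂ) : recA f 0 = fun _ => 1 := by simp [recA, recIntTilde]

theorem recB_zero (f : ℝ → ℂ) : recB f 0 = fun _ => 1 := by simp [recB, recInt]

/-- The exponent (−1)^n alternates with n exactly as the choice between X and X̃ does, so after
regrouping by parity the weight no longer depends on k: always f⁻² here, and always f² in
`recB_succ`. -/
theorem recA_succ (f : ℝ → ℂ) (k : ℕ) (x : ℝ) :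
    recA f (k + 1) x = ((k + 1 : ℕ) : ℂ) * ∫ s in (0 : ℝ)..x, recB f k s * (f s ^ 2)⁻¹ := by
  rcases Nat.even_or_odd k with hk | hk
  · have h1 : Odd (k + 1) := hk.add_one
    simp [recA, recB, recInt, Nat.not_odd_iff_even.2 hk, h1, h1.neg_one_pow]
  · have h1 : Even (k + 1) := hk.add_one
    simp [recA, recB, recIntTilde, Nat.not_odd_iff_even.2 h1, hk, hk.neg_one_pow]

theorem recB_succ (f : ℝ → ℂ) (k : ℕ) (x : ℝ) :
    recB f (k + 1) x = ((k + 1 : ℕ) : ℂ) * ∫ s in (0 : ℝ)..x, recA f k s * f s ^ 2 := by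
  rcases Nat.even_or_odd k with hk | hk
  · have h1 : Odd (k + 1) := hk.add_one
    simp [recA, recB, recIntTilde, Nat.not_odd_iff_even.2 hk, h1, hk.neg_one_pow]
  · have h1 : Even (k + 1) := hk.add_one
    simp [recA, recB, recInt, Nat.not_odd_iff_even.2 h1, hk, h1.neg_one_pow]

theorem recA_succ_zero (f : ℝ → ℂ) (k : ℕ) : recA f (k + 1) 0 = 0 := by simp [recA_succ]

theorem recB_succ_zero (f : ℝ → ℂ) (k : ℕ) : recB f (k + 1) 0 = 0 := by simp [recB_succ]

theorem intervalIntegrable_mul_bounded {a M : ℝ} {g m : ℝ → ℂ} (ha : 0 < a)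
    (hg : ContinuousOn g (Set.Icc (-a) a)) (hm : ContinuousOn m (Set.Ioo (-a) a))
    (hM : ∀ x ∈ Set.Icc (-a) a, ‖m x‖ ≤ M) :
    IntervalIntegrable (fun s => g s * m s) volume (-a) a := by
  obtain ⟨N, hN⟩ := isCompact_Icc.exists_bound_of_continuousOn hg
  rw [intervalIntegrable_iff_integrableOn_Ioo_of_le (by linarith)]
  refine Integrable.of_bound
    (((hg.mono Set.Ioo_subset_Icc_self).mul hm).aestronglyMeasurable measurableSet_Ioo) (N * M) ?_
  rw [ae_restrict_iff' measurableSet_Ioo]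
  refine Eventually.of_forall fun x hx => ?_
  have hx' := Set.Ioo_subset_Icc_self hx
  rw [norm_mul]
  exact mul_le_mul (hN x hx') (hM x hx') (norm_nonneg _) ((norm_nonneg _).trans (hN x hx'))

/-- The weights f^{±2} may be discontinuous at ±a; boundedness alone makes the primitives continuous
up to the end points. -/
theorem continuousOn_integral_mul_bounded {a M : ℝ} {g m : ℝ → ℂ} (ha : 0 < a)
    (hg : ContinuousOn g (Set.Icc (-a) a)) (hm : ContinuousOn m (Set.Ioo (-a) a))
    (hM : ∀ x ∈ Set.Icc (-a) a, ‖m x‖ ≤ M) :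
    ContinuousOn (fun x => ∫ s in (0 : ℝ)..x, g s * m s) (Set.Icc (-a) a) := by
  have h := intervalIntegral.continuousOn_primitive_interval' (a := 0)
    (intervalIntegrable_mul_bounded ha hg hm hM)
    (by rw [Set.uIcc_of_le (by linarith)]; exact ⟨by linarith, ha.le⟩)
  rwa [Set.uIcc_of_le (by linarith)] at h

theorem hasDerivAt_integral_mul {a : ℝ} {g m : ℝ → ℂ} (ha : 0 < a)
    (hg : ContinuousOn g (Set.Icc (-a) a)) (hm : ContinuousOn m (Set.Ioo (-a) a))
    {x : ℝ} (hx : x ∈ Set.Ioo (-a) a) :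
    HasDerivAt (fun x => ∫ s in (0 : ℝ)..x, g s * m s) (g x * m x) x := by
  have hc : ContinuousOn (fun s => g s * m s) (Set.Ioo (-a) a) :=
    (hg.mono Set.Ioo_subset_Icc_self).mul hm
  refine intervalIntegral.integral_hasDerivAt_right ?_
    (hc.stronglyMeasurableAtFilter isOpen_Ioo x hx) (hc.continuousAt (isOpen_Ioo.mem_nhds hx))
  refine ContinuousOn.intervalIntegrable (hc.mono ?_)
  exact (convex_Ioo (-a) a).ordConnected.uIcc_subset ⟨by linarith, ha⟩ hx

section Recursive

variable {a M : ℝ} {f : ℝ → ℂ}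

theorem continuousOn_recA_recB (ha : 0 < a) (hf : ContinuousOn f (Set.Ioo (-a) a))
    (hne : ∀ x ∈ Set.Icc (-a) a, f x ≠ 0)
    (hM : ∀ x ∈ Set.Icc (-a) a, ‖f x‖ ≤ M ∧ ‖1 / f x‖ ≤ M) (k : ℕ) :
    ContinuousOn (recA f k) (Set.Icc (-a) a) ∧ ContinuousOn (recB f k) (Set.Icc (-a) a) := by
  have m1 : ContinuousOn (fun s => (f s ^ 2)⁻¹) (Set.Ioo (-a) a) :=
    (hf.pow 2).inv₀ fun x hx => pow_ne_zero 2 (hne x (Set.Ioo_subset_Icc_self hx))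
  have b1 : ∀ x ∈ Set.Icc (-a) a, ‖(f x ^ 2)⁻¹‖ ≤ M ^ 2 := fun x hx => by
    have h := pow_le_pow_left₀ (norm_nonneg _) (hM x hx).2 2
    rwa [← norm_pow, one_div, inv_pow] at h
  have b2 : ∀ x ∈ Set.Icc (-a) a, ‖f x ^ 2‖ ≤ M ^ 2 := fun x hx => by
    rw [norm_pow]
    exact pow_le_pow_left₀ (norm_nonneg _) (hM x hx).1 2
  induction k with
  | zero => exact ⟨by rw [recA_zero]; fun_prop, by rw [recB_zero]; fun_prop⟩
  | succ k ih =>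
    have e1 : recA f (k + 1) = _ := funext (recA_succ f k)
    have e2 : recB f (k + 1) = _ := funext (recB_succ f k)
    rw [e1, e2]
    exact ⟨continuousOn_const.mul (continuousOn_integral_mul_bounded ha ih.2 m1 b1),
      continuousOn_const.mul (continuousOn_integral_mul_bounded ha ih.1 (hf.pow 2) b2)⟩

theorem hasDerivAt_recA (ha : 0 < a) (hf : ContinuousOn f (Set.Ioo (-a) a))
    (hne : ∀ x ∈ Set.Icc (-a) a, f x ≠ 0)
    (hM : ∀ x ∈ Set.Icc (-a) a, ‖f x‖ ≤ M ∧ ‖1 / f x‖ ≤ M) (k : ℕ) {x : ℝ}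
    (hx : x ∈ Set.Ioo (-a) a) :
    HasDerivAt (recA f (k + 1)) (((k + 1 : ℕ) : ℂ) * recB f k x / f x ^ 2) x := by
  have e1 : recA f (k + 1) = _ := funext (recA_succ f k)
  rw [e1]
  have m1 : ContinuousOn (fun s => (f s ^ 2)⁻¹) (Set.Ioo (-a) a) :=
    (hf.pow 2).inv₀ fun x hx => pow_ne_zero 2 (hne x (Set.Ioo_subset_Icc_self hx))
  refine ((hasDerivAt_integral_mul ha (continuousOn_recA_recB ha hf hne hM k).2 m1
    hx).const_mul _).congr_deriv ?_
  rw [div_eq_mul_inv, mul_assoc]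

theorem hasDerivAt_recB (ha : 0 < a) (hf : ContinuousOn f (Set.Ioo (-a) a))
    (hne : ∀ x ∈ Set.Icc (-a) a, f x ≠ 0)
    (hM : ∀ x ∈ Set.Icc (-a) a, ‖f x‖ ≤ M ∧ ‖1 / f x‖ ≤ M) (k : ℕ) {x : ℝ}
    (hx : x ∈ Set.Ioo (-a) a) :
    HasDerivAt (recB f (k + 1)) (((k + 1 : ℕ) : ℂ) * (recA f k x * f x ^ 2)) x := by
  have e1 : recB f (k + 1) = _ := funext (recB_succ f k)
  rw [e1]
  exact (hasDerivAt_integral_mul ha (continuousOn_recA_recB ha hf hne hM k).1 (hf.pow 2)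
    hx).const_mul _

theorem eqOn_of_hasDerivAt_eq {g₁ g₂ g' : ℝ → ℂ} (ha : 0 < a)
    (h1 : ∀ x ∈ Set.Ioo (-a) a, HasDerivAt g₁ (g' x) x)
    (h2 : ∀ x ∈ Set.Ioo (-a) a, HasDerivAt g₂ (g' x) x) (h0 : g₁ 0 = g₂ 0) :
    Set.EqOn g₁ g₂ (Set.Ioo (-a) a) :=
  isOpen_Ioo.eqOn_of_deriv_eq isPreconnected_Ioo
    (fun x hx => (h1 x hx).differentiableAt.differentiableWithinAt)
    (fun x hx => (h2 x hx).differentiableAt.differentiableWithinAt)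
    (fun x hx => (h1 x hx).deriv.trans (h2 x hx).deriv.symm) (x := 0) ⟨by linarith, ha⟩ h0

/-- Pólya factorization of `y'' - q y = G` by a zero-free solution `f` of `f'' = q f`. -/
theorem eqOn_mul_of_polya {q f' y y' G A B : ℝ → ℂ} (ha : 0 < a)
    (hne : ∀ x ∈ Set.Icc (-a) a, f x ≠ 0) (hf0 : f 0 = 1)
    (hf : ∀ x ∈ Set.Ioo (-a) a, HasDerivAt f (f' x) x)
    (hf' : ∀ x ∈ Set.Ioo (-a) a, HasDerivAt f' (q x * f x) x)
    (hy : ∀ x ∈ Set.Ioo (-a) a, HasDerivAt y (y' x) x)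
    (hy' : ∀ x ∈ Set.Ioo (-a) a, HasDerivAt y' (q x * y x + G x) x)
    (hB : ∀ x ∈ Set.Ioo (-a) a, HasDerivAt B (f x * G x) x)
    (hA : ∀ x ∈ Set.Ioo (-a) a, HasDerivAt A (B x / f x ^ 2) x)
    (hB0 : y' 0 - f' 0 * y 0 = B 0) (hA0 : y 0 = A 0) :
    ∀ x ∈ Set.Ioo (-a) a, y x = f x * A x := by
  -- The Wronskian of f and y has derivative f (y'' − qy) = f G.
  have hW : Set.EqOn (fun x => f x * y' x - f' x * y x) B (Set.Ioo (-a) a) := by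
    refine eqOn_of_hasDerivAt_eq ha (fun x hx => ?_) hB (by simpa [hf0] using hB0)
    exact (((hf x hx).mul (hy' x hx)).sub ((hf' x hx).mul (hy x hx))).congr_deriv (by ring)
  -- (y/f)' is the Wronskian divided by f².
  have hQ : Set.EqOn (fun x => y x / f x) A (Set.Ioo (-a) a) := by
    refine eqOn_of_hasDerivAt_eq ha (fun x hx => ?_) hA (by simpa [hf0] using hA0)
    refine ((hy x hx).div (hf x hx) (hne x (Set.Ioo_subset_Icc_self hx))).congr_deriv ?_
    rw [← hW hx]
    simp only
    ring
  intro x hx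
  have h := hQ hx
  have := hne x (Set.Ioo_subset_Icc_self hx)
  simp only at h
  rw [← h]
  field_simp

end Recursive

/-! ### The images of the powers -/

/-- The coefficient of the correction to `x ^ k`. -/
noncomputable def powCoeff (h : ℂ) (k : ℕ) : ℂ := if Even k then h / ((k + 1 : ℕ) : ℂ) else 0

/-- The polynomial `x ^ k + (h / 2) ∫_{-x}^x t ^ k dt`. -/
noncomputable def powH (h : ℂ) (k : ℕ) (t : ℝ) : ℂ := (t : ℂ) ^ k + powCoeff h k * (t : ℂ) ^ (k + 1)

/-- The derivative of `powH h k`. -/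
noncomputable def powH' (h : ℂ) (k : ℕ) (t : ℝ) : ℂ :=
  (k : ℂ) * (t : ℂ) ^ (k - 1) + powCoeff h k * (((k + 1 : ℕ) : ℂ) * (t : ℂ) ^ k)

theorem hasDerivAt_ofReal_pow (k : ℕ) (t : ℝ) :
    HasDerivAt (fun t : ℝ => (t : ℂ) ^ k) ((k : ℂ) * (t : ℂ) ^ (k - 1)) t :=
  (hasDerivAt_pow k (t : ℂ)).comp_ofReal

theorem hasDerivAt_powH (h : ℂ) (k : ℕ) (t : ℝ) : HasDerivAt (powH h k) (powH' h k t) t :=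
  (hasDerivAt_ofReal_pow k t).add ((hasDerivAt_ofReal_pow (k + 1) t).const_mul _)

theorem continuous_powH (h : ℂ) (k : ℕ) : Continuous (powH h k) := by unfold powH; fun_prop

theorem hasDerivAt_powH'_add_two (h : ℂ) (k : ℕ) (t : ℝ) :
    HasDerivAt (powH' h (k + 2)) (((k + 2 : ℕ) : ℂ) * ((k + 1 : ℕ) : ℂ) * powH h k t) t := by
  refine (((hasDerivAt_ofReal_pow (k + 1) t).const_mul _).add
    (((hasDerivAt_ofReal_pow (k + 2) t).const_mul _).const_mul _)).congr_deriv ?_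
  -- Both sides equal h for even k and 0 for odd k, so the correction terms obey the same
  -- second-derivative rule as the powers.
  have e : powCoeff h (k + 2) * ((k + 3 : ℕ) : ℂ) = powCoeff h k * ((k + 1 : ℕ) : ℂ) := by
    unfold powCoeff
    have h1 : ((k + 1 : ℕ) : ℂ) ≠ 0 := Nat.cast_ne_zero.2 (by lia)
    have h2 : ((k + 3 : ℕ) : ℂ) ≠ 0 := Nat.cast_ne_zero.2 (by lia)
    by_cases hk : Even k
    · have : Even (k + 2) := hk.add even_two
      simp only [this, hk, if_true]
      rw [div_mul_cancel₀ _ h2, div_mul_cancel₀ _ h1]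
    · have : ¬ Even (k + 2) := by rwa [Nat.even_add, iff_true_right even_two]
      simp only [this, hk, if_false, zero_mul]
  simp only [powH, add_tsub_cancel_right, show k + 2 - 1 = k + 1 from rfl,
    show k + 2 + 1 = k + 3 from rfl]
  linear_combination (((k + 2 : ℕ) : ℂ) * (t : ℂ) ^ (k + 1)) * e

theorem powH_eq (h : ℂ) (k : ℕ) :
    (fun t : ℝ => (t : ℂ) ^ k + h / 2 * ∫ s in (-t)..t, (s : ℂ) ^ k) = powH h k := by
  ext t
  have hi : ∫ s in (-t)..t, (s : ℂ) ^ k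
      = ((t : ℂ) ^ (k + 1) - (-(t : ℂ)) ^ (k + 1)) / ((k + 1 : ℕ) : ℂ) := by
    have h1 : ∀ s : ℝ, (s : ℂ) ^ k = ((s ^ k : ℝ) : ℂ) := fun s => by push_cast; rfl
    simp only [h1]
    rw [intervalIntegral.integral_ofReal, integral_pow]
    push_cast
    rfl
  rw [hi, powH, powCoeff]
  have h1 : ((k + 1 : ℕ) : ℂ) ≠ 0 := Nat.cast_ne_zero.2 (by lia)
  by_cases hk : Even k
  · rw [if_pos hk, hk.add_one.neg_pow]
    field_simp
    ring
  · rw [if_neg hk, (Nat.not_even_iff_odd.1 hk).add_one.neg_pow]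
    simp

/-- The images of the powers are the functions `phi`, in the interior of the interval. -/
theorem transmute_powH {a M : ℝ} {q Q f : ℝ → ℂ} {H : ℝ × ℝ → ℂ} (ha : 0 < a)
    (hQ : Continuous Q) (hH : Continuous H)
    (heq : ∀ p, H p = 1 / 2 * (∫ s in (0 : ℝ)..p.1, Q s) + goursatInt Q H p)
    (hqQ : ∀ x ∈ Set.Icc (-a) a, Q x = q x)
    (hf : ContDiffOn ℝ 2 f (Set.Ioo (-a) a))
    (hsol : ∀ x ∈ Set.Ioo (-a) a, deriv (deriv f) x = q x * f x)
    (hne : ∀ x ∈ Set.Icc (-a) a, f x ≠ 0)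
    (hM : ∀ x ∈ Set.Icc (-a) a, ‖f x‖ ≤ M ∧ ‖1 / f x‖ ≤ M)
    (hf0 : f 0 = 1) (k : ℕ) :
    ∀ x ∈ Set.Ioo (-a) a, transmute H (powH (deriv f 0) k) x = f x * recA f k x := by
  set h := deriv f 0 with hh
  have f1 : ∀ x ∈ Set.Ioo (-a) a, HasDerivAt f (deriv f x) x := fun x hx =>
    ((hf.differentiableOn (by norm_num)).differentiableAt (isOpen_Ioo.mem_nhds hx)).hasDerivAt
  have f2 : ∀ x ∈ Set.Ioo (-a) a, HasDerivAt (deriv f) (Q x * f x) x := fun x hx => by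
    have hd : ContDiffOn ℝ 1 (deriv f) (Set.Ioo (-a) a) :=
      ((contDiffOn_succ_iff_deriv_of_isOpen (n := 1) isOpen_Ioo).1 hf).2.2
    have := ((hd.differentiableOn (by norm_num)).differentiableAt
      (isOpen_Ioo.mem_nhds hx)).hasDerivAt
    rwa [hsol x hx, ← hqQ x (Set.Ioo_subset_Icc_self hx)] at this
  have fc : ContinuousOn f (Set.Ioo (-a) a) := hf.continuousOn
  have y0 : ∀ p, transmute H p 0 = p 0 := fun p => by simp [transmute]
  have y'0 : ∀ p p', transmuteDeriv Q H p p' 0 = p' 0 := fun p p' => by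
    simp [transmuteDeriv, goursat_fst_zero heq]
  have c' : ∀ k, Continuous (powH' h k) := fun k => by unfold powH'; fun_prop
  have t0 : ∀ x, transmute H (fun _ => 0) x = 0 := fun x => by simp [transmute]
  induction k using Nat.twoStepInduction with
  | zero =>
    -- Here the polynomial is 1 + hx, whose image has the Cauchy data of f, so the Wronskian
    -- vanishes.
    refine eqOn_mul_of_polya (q := Q) (B := fun _ => 0) ha hne hf0 f1 f2
      (fun x _ => hasDerivAt_transmute hQ hH heq (hasDerivAt_powH h 0) (c' 0) x)
      (fun x _ => hasDerivAt_transmuteDeriv (p'' := fun _ => 0) hQ hH heq (hasDerivAt_powH h 0)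
        (fun t => ?_) continuous_const x) (fun x _ => ?_) (fun x _ => ?_) ?_ ?_
    · have : powH' h 0 = fun _ => h := by ext; simp [powH', powCoeff]
      rw [this]
      exact hasDerivAt_const t h
    · rw [t0, mul_zero]; exact hasDerivAt_const x 0
    · rw [recA_zero, zero_div]; exact hasDerivAt_const x 1
    · rw [y0, y'0, ← hh]; simp [powH, powH', powCoeff]
    · rw [y0, recA_zero]; simp [powH]
  | one =>
    -- Here the polynomial is x, with Cauchy data (0, 1) and hence constant Wronskian 1.
    refine eqOn_mul_of_polya (q := Q) (B := fun _ => 1) ha hne hf0 f1 f2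
      (fun x _ => hasDerivAt_transmute hQ hH heq (hasDerivAt_powH h 1) (c' 1) x)
      (fun x _ => hasDerivAt_transmuteDeriv (p'' := fun _ => 0) hQ hH heq (hasDerivAt_powH h 1)
        (fun t => ?_) continuous_const x) (fun x _ => ?_) (fun x hx => ?_) ?_ ?_
    · have : powH' h 1 = fun _ => 1 := by ext; simp [powH', powCoeff]
      rw [this]
      exact hasDerivAt_const t 1
    · rw [t0, mul_zero]; exact hasDerivAt_const x 1
    · simpa [recB_zero] using hasDerivAt_recA ha fc hne hM 0 hx
    · rw [y0, y'0, ← hh]; simp [powH, powH', powCoeff]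
    · rw [y0, recA_succ_zero]; simp [powH]
  | more k ih _ =>
    -- By induction f G = (k+2)(k+1) f² `recA f k`, the derivative of this `B`; all Cauchy data
    -- vanish at 0.
    refine eqOn_mul_of_polya (q := Q) (B := fun x => ((k + 2 : ℕ) : ℂ) * recB f (k + 1) x)
      ha hne hf0 f1 f2
      (fun x _ => hasDerivAt_transmute hQ hH heq (hasDerivAt_powH h (k + 2)) (c' (k + 2)) x)
      (fun x _ => hasDerivAt_transmuteDeriv hQ hH heq (hasDerivAt_powH h (k + 2))
        (hasDerivAt_powH'_add_two h k) (continuous_const.mul (continuous_powH h k)) x)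
      (fun x hx => ?_) (fun x hx => hasDerivAt_recA ha fc hne hM (k + 1) hx) ?_ ?_
    · rw [transmute_const_mul, ih x hx]
      exact ((hasDerivAt_recB ha fc hne hM k hx).const_mul _).congr_deriv (by ring)
    · rw [y0, y'0, recB_succ_zero]; simp [powH, powH']
    · rw [y0, recA_succ_zero]; simp [powH]

/-! ### Uniqueness -/

/-- Two mean value inequalities bound the mixed difference, first in u for `Wv`, then in v for `W`;
each gains a factor 1/l. The corners stay off the axes because derivatives are assumed only in the
open triangle. -/
theorem goursat_rectangle_le {W Wv : ℝ → ℝ → ℂ} {q : ℝ → ℂ} {C M l a u₁ u₂ v₁ v₂ : ℝ}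
    (hC : 0 ≤ C) (hM : 0 ≤ M) (hl : 0 < l)
    (hd : ∀ u v, 0 < u → 0 < v → u + v < a → HasDerivAt (fun w => W u w) (Wv u v) v)
    (he : ∀ u v, 0 < u → 0 < v → u + v < a → HasDerivAt (fun r => Wv r v) (q (u + v) * W u v) u)
    (hq : ∀ x ∈ Set.Icc 0 a, ‖q x‖ ≤ C)
    (hW : ∀ u v, 0 ≤ u → 0 ≤ v → u + v ≤ a → ‖W u v‖ ≤ M * Real.exp (l * (u + v)))
    (hc : ContinuousOn (fun p : ℝ × ℝ => W p.1 p.2) {p | 0 ≤ p.1 ∧ 0 ≤ p.2 ∧ p.1 + p.2 ≤ a})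
    (hu₁ : 0 < u₁) (hu : u₁ ≤ u₂) (hv₁ : 0 < v₁) (hv : v₁ ≤ v₂) (hle : u₂ + v₂ ≤ a) :
    ‖(W u₂ v₂ - W u₁ v₂) - (W u₂ v₁ - W u₁ v₁)‖ ≤ C * M / l / l * Real.exp (l * (u₂ + v₂)) := by
  have hexp : ∀ (K b x : ℝ), HasDerivAt (fun r => K / l * Real.exp (l * (b + r)))
      (K * Real.exp (l * (b + x))) x := fun K b x => by
    refine (((((hasDerivAt_id x).const_add b).const_mul l).exp).const_mul (K / l)).congr_deriv ?_
    simp only [id]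
    field_simp
  -- Excluding w = v₂ keeps u₂ + w < a even when the far corner lies on the hypotenuse.
  have inner : ∀ w ∈ Set.Ico v₁ v₂, ‖Wv u₂ w - Wv u₁ w‖ ≤ C * M / l * Real.exp (l * (u₂ + w)) := by
    intro w hw
    have hD : ∀ r ∈ Set.Icc u₁ u₂, HasDerivAt (fun r => Wv r w - Wv u₁ w)
        (q (r + w) * W r w) r := fun r hr =>
      (he r w (by linarith [hr.1]) (by linarith [hw.1]) (by linarith [hr.2, hw.2])).sub_const _
    have := image_norm_le_of_norm_deriv_right_le_deriv_boundary (a := u₁) (b := u₂)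
      (fun r hr => (hD r hr).continuousAt.continuousWithinAt)
      (fun r hr => (hD r (Set.Ico_subset_Icc_self hr)).hasDerivWithinAt)
      (B := fun r => C * M / l * Real.exp (l * (w + r))) (by simp; positivity) (hexp (C * M) w)
      (fun r hr => by
        rw [norm_mul, mul_assoc C]
        have h1 : 0 ≤ r := by linarith [hr.1]
        have h2 : 0 ≤ w := by linarith [hw.1]
        have h3 : r + w ≤ a := by linarith [hr.2, hw.2]
        rw [add_comm w r]
        exact mul_le_mul (hq _ ⟨by linarith, h3⟩) (hW r w h1 h2 h3) (norm_nonneg _) hC)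
      (Set.right_mem_Icc.2 hu)
    rwa [add_comm w] at this
  have hcont : ∀ u, 0 ≤ u → u ≤ u₂ → ContinuousOn (fun w => W u w) (Set.Icc v₁ v₂) := by
    intro u h0 h2
    refine hc.comp (f := fun w => (u, w)) (by fun_prop) fun w hw => ?_
    exact ⟨h0, by simp only; linarith [hw.1], by simp only; linarith [hw.2]⟩
  refine image_norm_le_of_norm_deriv_right_le_deriv_boundary (a := v₁) (b := v₂)
    (f := fun w => (W u₂ w - W u₁ w) - (W u₂ v₁ - W u₁ v₁))
    (f' := fun w => Wv u₂ w - Wv u₁ w)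
    (((hcont u₂ (by linarith) le_rfl).sub (hcont u₁ hu₁.le hu)).sub continuousOn_const)
    (fun w hw => ?_) (B := fun w => C * M / l / l * Real.exp (l * (u₂ + w)))
    (by simp; positivity) (hexp (C * M / l) u₂) inner (Set.right_mem_Icc.2 hv)
  have h1 : 0 < w := by linarith [hw.1]
  have h2 : u₂ + w < a := by linarith [hw.2]
  exact (((hd u₂ w (by linarith) h1 h2).sub (hd u₁ w hu₁ h1 (by linarith))).sub_const
    _).hasDerivWithinAt

/-- Let M be the maximum of |W| e^{-l(u+v)} on the compact triangle. At a maximum point off the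
axes, shrinking the lower left corner of the rectangle to the origin removes the three other vertex
values, so M ≤ (C/l²) M and M = 0. -/
theorem goursat_eq_zero {W Wv : ℝ → ℝ → ℂ} {q : ℝ → ℂ} {C a : ℝ} (ha : 0 < a)
    (hd : ∀ u v, 0 < u → 0 < v → u + v < a → HasDerivAt (fun w => W u w) (Wv u v) v)
    (he : ∀ u v, 0 < u → 0 < v → u + v < a → HasDerivAt (fun r => Wv r v) (q (u + v) * W u v) u)
    (hq : ∀ x ∈ Set.Icc 0 a, ‖q x‖ ≤ C)
    (hc : ContinuousOn (fun p : ℝ × ℝ => W p.1 p.2) {p | 0 ≤ p.1 ∧ 0 ≤ p.2 ∧ p.1 + p.2 ≤ a})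
    (hu : ∀ u, 0 ≤ u → u ≤ a → W u 0 = 0) (hv : ∀ v, 0 ≤ v → v ≤ a → W 0 v = 0)
    {u v : ℝ} (hu0 : 0 ≤ u) (hv0 : 0 ≤ v) (huv : u + v ≤ a) : W u v = 0 := by
  have hC : 0 ≤ C := (norm_nonneg _).trans (hq 0 ⟨le_rfl, ha.le⟩)
  set l : ℝ := C + 1 with hl
  have hl0 : 0 < l := by positivity
  have hθ : C / l / l < 1 := by
    rw [div_div, div_lt_one (by positivity)]; nlinarith
  set T : Set (ℝ × ℝ) := {p | 0 ≤ p.1 ∧ 0 ≤ p.2 ∧ p.1 + p.2 ≤ a} with hT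
  have Tc : IsCompact T := by
    refine ((isCompact_Icc (a := (0 : ℝ)) (b := a)).prod
      (isCompact_Icc (a := (0 : ℝ)) (b := a))).of_isClosed_subset ?_ ?_
    · exact (isClosed_le continuous_const continuous_fst).inter
        ((isClosed_le continuous_const continuous_snd).inter
          (isClosed_le (by fun_prop : Continuous fun p : ℝ × ℝ => p.1 + p.2) continuous_const))
    · rintro p ⟨h1, h2, h3⟩
      exact ⟨⟨h1, by linarith⟩, ⟨h2, by linarith⟩⟩
  obtain ⟨p₀, hp₀, hmax⟩ := Tc.exists_isMaxOn ⟨(0, 0), by simp [hT, ha.le]⟩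
    (f := fun p => ‖W p.1 p.2‖ * Real.exp (-(l * (p.1 + p.2))))
    (hc.norm.mul (by fun_prop))
  set M : ℝ := ‖W p₀.1 p₀.2‖ * Real.exp (-(l * (p₀.1 + p₀.2))) with hMdef
  have hM : 0 ≤ M := by positivity
  have hW : ∀ u v, 0 ≤ u → 0 ≤ v → u + v ≤ a → ‖W u v‖ ≤ M * Real.exp (l * (u + v)) := by
    intro u v h1 h2 h3
    have : ‖W u v‖ * Real.exp (-(l * (u + v))) ≤ M := hmax (show (u, v) ∈ T from ⟨h1, h2, h3⟩)
    rwa [Real.exp_neg, ← div_eq_mul_inv, div_le_iff₀ (Real.exp_pos _)] at this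
  obtain ⟨x, y⟩ := p₀
  obtain ⟨hx, hy, hxy⟩ := hp₀
  simp only at hx hy hxy hMdef
  have key : ‖W x y‖ ≤ C * M / l / l * Real.exp (l * (x + y)) := by
    rcases hx.eq_or_lt with rfl | hx
    · rw [hv y hy (by linarith), norm_zero]; positivity
    rcases hy.eq_or_lt with rfl | hy
    · rw [hu x hx.le (by linarith), norm_zero]; positivity
    have lim : ∀ (γ : ℝ → ℝ × ℝ), Continuous γ → (∀ᶠ ε in 𝓝[>] (0 : ℝ), γ ε ∈ T) → γ 0 ∈ T →
        Tendsto (fun ε => W (γ ε).1 (γ ε).2) (𝓝[>] 0) (𝓝 (W (γ 0).1 (γ 0).2)) := by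
      intro γ hγ h1 h2
      exact (hc (γ 0) h2).tendsto.comp
        (tendsto_nhdsWithin_iff.2 ⟨hγ.continuousAt.continuousWithinAt.tendsto, h1⟩)
    have ev : ∀ᶠ ε in 𝓝[>] (0 : ℝ), 0 < ε ∧ ε < x ∧ ε < y := by
      filter_upwards [self_mem_nhdsWithin, mem_nhdsWithin_of_mem_nhds (Iio_mem_nhds hx),
        mem_nhdsWithin_of_mem_nhds (Iio_mem_nhds hy)] with ε h1 h2 h3 using ⟨h1, h2, h3⟩
    have l1 := lim (fun ε => (ε, y)) (by fun_prop)
      (ev.mono fun ε h => ⟨h.1.le, hy.le, by simp only; linarith [h.2.1]⟩)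
      ⟨le_rfl, hy.le, by simp only; linarith⟩
    have l2 := lim (fun ε => (x, ε)) (by fun_prop)
      (ev.mono fun ε h => ⟨hx.le, h.1.le, by simp only; linarith [h.2.2]⟩)
      ⟨hx.le, le_rfl, by simp only; linarith⟩
    have l3 := lim (fun ε => (ε, ε)) (by fun_prop)
      (ev.mono fun ε h => ⟨h.1.le, h.1.le, by simp only; linarith [h.2.1, h.2.2]⟩)
      ⟨le_rfl, le_rfl, by simp only; linarith⟩
    simp only at l1 l2 l3
    rw [hv y hy.le (by linarith)] at l1
    rw [hu x hx.le (by linarith)] at l2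
    rw [hv 0 le_rfl ha.le] at l3
    have l4 := (((tendsto_const_nhds (x := W x y)).sub l1).sub (l2.sub l3)).norm
    simp only [sub_zero] at l4
    exact le_of_tendsto l4 (ev.mono fun ε h => goursat_rectangle_le hC hM hl0 hd he hq hW hc
      h.1 h.2.1.le h.1 h.2.2.le hxy)
  have h1 : M ≤ C / l / l * M := by
    have h := mul_le_mul_of_nonneg_right key (Real.exp_pos (-(l * (x + y)))).le
    rw [mul_assoc (C * M / l / l), ← Real.exp_add, add_neg_cancel, Real.exp_zero] at h
    exact h.trans_eq (by ring)
  have hM0 : M = 0 := by nlinarith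
  have := hW u v hu0 hv0 huv
  rw [hM0, zero_mul] at this
  exact norm_le_zero_iff.1 this

theorem goursatDomain_of_nonneg {a u v : ℝ} (hu : 0 ≤ u) (hv : 0 ≤ v) (h : u + v ≤ a) :
    (u, v) ∈ goursatDomain a :=
  ⟨mul_nonneg hu hv, by simp only; rwa [abs_of_nonneg (by positivity)]⟩

theorem goursatDomain_of_nonpos {a u v : ℝ} (hu : 0 ≤ u) (hv : 0 ≤ v) (h : u + v ≤ a) :
    (-u, -v) ∈ goursatDomain a := by
  refine ⟨by simpa using mul_nonneg hu hv, ?_⟩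
  simp only
  rwa [← neg_add, abs_neg, abs_of_nonneg (by positivity)]

theorem IsGoursatSolution.unique {q : ℝ → ℂ} {a : ℝ} (ha : 0 < a)
    (hq : ContinuousOn q (Set.Icc (-a) a)) {H₁ H₂ : ℝ → ℝ → ℂ} (h₁ : IsGoursatSolution q a H₁)
    (h₂ : IsGoursatSolution q a H₂) {p : ℝ × ℝ} (hp : p ∈ goursatDomain a) :
    H₁ p.1 p.2 = H₂ p.1 p.2 := by
  obtain ⟨C, hC⟩ := isCompact_Icc.exists_bound_of_continuousOn hq
  set D : ℝ → ℝ → ℂ := fun u v => H₁ u v - H₂ u v with hD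
  set Dv : ℝ → ℝ → ℂ := fun u v => deriv (fun w => H₁ u w) v - deriv (fun w => H₂ u w) v with hDv
  have Dd : ∀ u v, 0 < u * v → |u + v| < a → HasDerivAt (fun w => D u w) (Dv u v) v :=
    fun u v h h' => (h₁.differentiableAt u v h h').hasDerivAt.sub
      (h₂.differentiableAt u v h h').hasDerivAt
  have De : ∀ u v, 0 < u * v → |u + v| < a →
      HasDerivAt (fun r => Dv r v) (q (u + v) * D u v) u :=
    fun u v h h' => ((h₁.equation u v h h').sub (h₂.equation u v h h')).congr_deriv (by
      simp only [hD]; ring)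
  have Dc : ContinuousOn (fun p : ℝ × ℝ => D p.1 p.2) (goursatDomain a) :=
    h₁.continuousOn.sub h₂.continuousOn
  have Du : ∀ u ∈ Set.Icc (-a) a, D u 0 = 0 := fun u hu => by
    simp only [hD, h₁.data_left u hu, h₂.data_left u hu, sub_self]
  have Dv0 : ∀ v ∈ Set.Icc (-a) a, D 0 v = 0 := fun v hv => by
    simp only [hD, h₁.data_right v hv, h₂.data_right v hv, sub_self]
  have abs_lt : ∀ u v : ℝ, 0 < u → 0 < v → u + v < a → |u + v| < a := fun u v hu hv h => by
    rwa [abs_of_pos (by positivity)]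
  have abs_lt' : ∀ u v : ℝ, 0 < u → 0 < v → u + v < a → |-u + -v| < a := fun u v hu hv h => by
    rw [← neg_add, abs_neg]; exact abs_lt u v hu hv h
  have pos : ∀ u v, 0 ≤ u → 0 ≤ v → u + v ≤ a → D u v = 0 := fun u v hu hv h =>
    goursat_eq_zero (Wv := Dv) (q := q) ha
      (fun u v hu hv h => Dd u v (mul_pos hu hv) (abs_lt u v hu hv h))
      (fun u v hu hv h => De u v (mul_pos hu hv) (abs_lt u v hu hv h))
      (fun x hx => hC x ⟨by linarith [hx.1], hx.2⟩)
      (Dc.mono fun p hp => goursatDomain_of_nonneg hp.1 hp.2.1 hp.2.2)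
      (fun u h0 h1 => Du u ⟨by linarith, h1⟩) (fun v h0 h1 => Dv0 v ⟨by linarith, h1⟩) hu hv h
  -- Reflection in the origin carries the second triangle to the first; the two signs cancel in the
  -- mixed derivative and the coefficient becomes q(−x).
  have neg : ∀ u v, 0 ≤ u → 0 ≤ v → u + v ≤ a → D (-u) (-v) = 0 := fun u v hu hv h =>
    goursat_eq_zero (W := fun u v => D (-u) (-v)) (Wv := fun u v => -Dv (-u) (-v))
      (q := fun x => q (-x)) ha
      (fun u v hu hv h => by
        have := (Dd (-u) (-v) (by simpa using mul_pos hu hv) (abs_lt' u v hu hv h)).scomp v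
          (hasDerivAt_neg v)
        exact this.congr_deriv (by simp))
      (fun u v hu hv h => by
        have := ((De (-u) (-v) (by simpa using mul_pos hu hv) (abs_lt' u v hu hv h)).scomp u
          (hasDerivAt_neg u)).neg
        exact this.congr_deriv (by simp [add_comm]))
      (fun x hx => hC (-x) ⟨by linarith [hx.2], by linarith [hx.1]⟩)
      (Dc.comp (f := fun p : ℝ × ℝ => (-p.1, -p.2)) (by fun_prop)
        fun p hp => goursatDomain_of_nonpos hp.1 hp.2.1 hp.2.2)
      (fun u h0 h1 => by simpa using Du (-u) ⟨by linarith, by linarith⟩)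
      (fun v h0 h1 => by simpa using Dv0 (-v) ⟨by linarith, by linarith⟩) hu hv h
  obtain ⟨u, v⟩ := p
  obtain ⟨h0, hle⟩ := hp
  simp only at h0 hle ⊢
  rw [← sub_eq_zero]
  rcases mul_nonneg_iff.1 h0 with ⟨hu, hv⟩ | ⟨hu, hv⟩
  · exact pos u v hu hv ((le_abs_self _).trans hle)
  · have := neg (-u) (-v) (by linarith) (by linarith) (by linarith [(abs_le.1 hle).1])
    rwa [neg_neg, neg_neg] at this

/-! ### Existence -/

theorem isGoursatSolution_of_integral_eq {q Q : ℝ → ℂ} {a : ℝ} {H : ℝ × ℝ → ℂ}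
    (hQ : Continuous Q) (hH : Continuous H)
    (heq : ∀ p, H p = 1 / 2 * (∫ s in (0 : ℝ)..p.1, Q s) + goursatInt Q H p)
    (hqQ : ∀ x ∈ Set.Icc (-a) a, Q x = q x) : IsGoursatSolution q a (fun u v => H (u, v)) where
  continuousOn := hH.continuousOn
  differentiableAt u v _ _ := (hasDerivAt_goursat_snd hQ hH heq u v).differentiableAt
  equation u v _ h := by
    have e : ∀ r, deriv (fun w => H (r, w)) v = goursatDeriv Q H (r, v) := fun r =>
      (hasDerivAt_goursat_snd hQ hH heq r v).deriv
    simp only [e]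
    rw [← hqQ _ (abs_le.1 h.le)]
    exact hasDerivAt_goursatDeriv_fst hQ hH u v
  data_left u hu := by
    rw [goursat_snd_zero heq]
    congr 1
    refine intervalIntegral.integral_congr fun s hs => hqQ s ?_
    have h0 : (0 : ℝ) ∈ Set.Icc (-a) a := ⟨by linarith [hu.1, hu.2], by linarith [hu.1, hu.2]⟩
    exact (convex_Icc (-a) a).ordConnected.uIcc_subset h0 hu hs
  data_right v _ := goursat_fst_zero heq v

end Transmutation

/-! ### Assembly and the end points -/

theorem mainTheorem4 (a : ℝ) (ha : 0 < a) (q f : ℝ → ℂ)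
    (hq : ContinuousOn q (Set.Icc (-a) a))
    (hf : ContDiffOn ℝ 2 f (Set.Ioo (-a) a))
    (hsol : ∀ x ∈ Set.Ioo (-a) a, deriv (deriv f) x = q x * f x)
    (hne : ∀ x ∈ Set.Icc (-a) a, f x ≠ 0)
    (hbdd : ∃ M : ℝ, ∀ x ∈ Set.Icc (-a) a, ‖f x‖ ≤ M ∧ ‖1 / f x‖ ≤ M)
    (hf0 : f 0 = 1) :
    ∃ H : ℝ → ℝ → ℂ,
      Transmutation.IsGoursatSolution q a H ∧
      (∀ H' : ℝ → ℝ → ℂ, Transmutation.IsGoursatSolution q a H' →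
        ∀ p ∈ Transmutation.goursatDomain a, H' p.1 p.2 = H p.1 p.2) ∧
      ∀ (k : ℕ), ∀ x ∈ Set.Icc (-a) a, ContinuousWithinAt f (Set.Icc (-a) a) x →
        Transmutation.opT H (deriv f 0) (fun t : ℝ => (t : ℂ) ^ k) x
          = Transmutation.phi f 0 k x := by
  obtain ⟨M, hM⟩ := hbdd
  have hle : -a ≤ a := by linarith
  obtain ⟨C, hC⟩ := isCompact_Icc.exists_bound_of_continuousOn hq
  -- Constant extension beyond ±a keeps both continuity and the bound C, as the iteration on the
  -- whole plane requires.
  set Q : ℝ → ℂ := Set.IccExtend hle ((Set.Icc (-a) a).domRestrict q) with hQdef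
  have hQ : Continuous Q := (continuousOn_iff_continuous_domRestrict.1 hq).Icc_extend'
  have hQC : ∀ x, ‖Q x‖ ≤ C := fun x => hC _ (Set.projIcc (-a) a hle x).2
  have hqQ : ∀ x ∈ Set.Icc (-a) a, Q x = q x := fun x hx => by
    rw [hQdef, Set.IccExtend_of_mem _ _ hx, Set.domRestrict_apply]
  obtain ⟨H, hH, heq⟩ := Transmutation.exists_goursat_integral_eq hQ hQC
  have hsolH := Transmutation.isGoursatSolution_of_integral_eq hQ hH heq hqQ
  refine ⟨fun u v => H (u, v), hsolH, fun H' hH' p hp => hH'.unique ha hq hsolH hp, ?_⟩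
  intro k x hx hfx
  rw [Transmutation.opT_eq_transmute hH _ (by fun_prop), Transmutation.powH_eq,
    Transmutation.phi_eq_mul_recA]
  have hin := Transmutation.transmute_powH ha hQ hH heq hqQ hf hsol hne hM hf0 k
  have hT : Continuous (Transmutation.transmute H (Transmutation.powH (deriv f 0) k)) :=
    continuous_iff_continuousAt.2 fun t =>
      (Transmutation.hasDerivAt_transmute hQ hH heq (Transmutation.hasDerivAt_powH _ k)
        (by unfold Transmutation.powH'; fun_prop) t).continuousAt
  have hA := (Transmutation.continuousOn_recA_recB ha hf.continuousOn hne hM k).1 x hx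
  have hcl : x ∈ closure (Set.Ioo (-a) a) := by rwa [closure_Ioo (by linarith)]
  have : (𝓝[Set.Ioo (-a) a] x).NeBot := mem_closure_iff_nhdsWithin_neBot.1 hcl
  -- Both sides are limits from the open interval, where they agree; continuity of f within [−a, a]
  -- at x is needed only for the right-hand side.
  refine tendsto_nhds_unique (f := Transmutation.transmute H _)
    (hT.continuousAt.continuousWithinAt (s := Set.Ioo (-a) a) (x := x)).tendsto ?_
  refine (((hfx.mul hA).mono Set.Ioo_subset_Icc_self).tendsto).congr' ?_
  filter_upwards [self_mem_nhdsWithin] with y hy using (hin y hy).symm
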